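/- For $n\ge 0$ let $Q_n$ be the $n$-cube: its vertices are the binary $n$-tuples, two being adjacent when they differ in exactly one coordinate. A sub-$d$-cube of $Q_n$ is obtained by letting some $d$ coordinates vary freely and fixing the other $n-d$; there are $\binom nd 2^{n-d}$ of them. For $H\subseteq V(Q_d)$, $S\subseteq V(Q_n)$ and a sub-$d$-cube $R$ of $Q_n$, we say that $S\cap R$ is an exact copy of $H$ if some graph isomorphism from $Q_d$ onto $R$ maps $H$ onto $S\cap R$. For $n \ge d$, let $\mathrm{ex}(H,d,n)$ be the maximum, over all $S\subseteq V(Q_n)$, of the fraction of sub-$d$-cubes $R$ of $Q_n$ for which $S\cap R$ is an exact copy of $H$, and let $\pi(H,d)=\lim_{n\to\infty}\mathrm{ex}(H,d,n)$. A perfect $8$-cycle in $Q_4$ is the vertex set $C_8$ of a cycle of length $8$ in $Q_4$ in which all four pairs of opposite vertices are at Hamming distance $4$. **Theorem.** Perfect $8$-cycles exist in $Q_4$, and for every perfect $8$-cycle $C_8$ in $Q_4$ the limit $\pi(C_8,4)$ exists and $$\pi(C_8,4)=\frac{3}{32}.$$ -/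

import Mathlib

open Filter Topology

/-- The vertex set of the `n`-cube: all binary `n`-tuples. -/
abbrev CubeVertex (n : ℕ) : Type := Fin n → Bool

/-- The `n`-cube: two binary `n`-tuples are adjacent iff they differ in exactly one coordinate. -/
def cubeGraph (n : ℕ) : SimpleGraph (CubeVertex n) where
  Adj x y := hammingDist x y = 1
  symm := ⟨fun x y h => by rw [hammingDist_comm]; exact h⟩
  loopless := ⟨fun x h => by simp [hammingDist_self] at h⟩

/-- `R` is (the vertex set of) a sub-`d`-cube of the `n`-cube: the coordinates in some `d`-element
set `J` vary freely and the remaining ones are fixed, with the values prescribed by `a`. -/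
def IsSubcube (d : ℕ) {n : ℕ} (R : Finset (CubeVertex n)) : Prop :=
  ∃ (J : Finset (Fin n)) (a : CubeVertex n), J.card = d ∧
    ∀ v : CubeVertex n, v ∈ R ↔ ∀ i, i ∉ J → v i = a i

/-- The intersection of `S` with `R` is an exact copy of the configuration `H` of the `d`-cube:
some graph isomorphism from the `d`-cube onto the subgraph induced on `R` maps `H` onto `S ∩ R`. -/
def IsExactCopyOn {d n : ℕ} (H : Finset (CubeVertex d)) (S R : Finset (CubeVertex n)) : Prop :=
  ∃ φ : cubeGraph d ≃g (cubeGraph n).induce (R : Set (CubeVertex n)),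
    ∀ x : CubeVertex d, x ∈ H ↔ (φ x : CubeVertex n) ∈ S

open Classical in
/-- The number of sub-`d`-cubes of the `n`-cube in which `S` is an exact copy of `H`. -/
noncomputable def goodCount {d : ℕ} (H : Finset (CubeVertex d)) {n : ℕ}
    (S : Finset (CubeVertex n)) : ℕ :=
  (Finset.univ.filter fun R : Finset (CubeVertex n) =>
    IsSubcube d R ∧ IsExactCopyOn H S R).card

/-- The maximum of `goodCount H S` over all sets `S` of vertices of the `n`-cube. -/
noncomputable def goodMax {d : ℕ} (H : Finset (CubeVertex d)) (n : ℕ) : ℕ :=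
  (Finset.univ : Finset (Finset (CubeVertex n))).sup fun S => goodCount H S

/-- The maximum fraction, over all `S`, of sub-`d`-cubes of the `n`-cube in which `S` is an exact
copy of `H`. It is meaningful for `d ≤ n`. -/
noncomputable def maxFraction {d : ℕ} (H : Finset (CubeVertex d)) (n : ℕ) : ℝ :=
  (goodMax H n : ℝ) / ((n.choose d : ℝ) * 2 ^ (n - d))

/-- The `d`-cube density of `H` exists and is equal to `x`. -/
def HasCubeDensity {d : ℕ} (H : Finset (CubeVertex d)) (x : ℝ) : Prop :=
  Tendsto (fun n : ℕ => maxFraction H n) atTop (𝓝 x)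

/-- `C` is a perfect `2d`-cycle in the `d`-cube: the vertex set of a cycle
`c 0, c 1, …, c (2d - 1)` of length `2d` all of whose `d` opposite pairs of vertices are at
Hamming distance `d`. -/
def IsPerfectCycle (d : ℕ) (C : Finset (CubeVertex d)) : Prop :=
  2 ≤ d ∧ ∃ c : ZMod (2 * d) → CubeVertex d,
    Function.Injective c ∧
    (∀ i, (cubeGraph d).Adj (c i) (c (i + 1))) ∧
    (∀ i, hammingDist (c i) (c (i + (d : ZMod (2 * d)))) = d) ∧
    ∀ v, v ∈ C ↔ ∃ i, c i = v

/-! Both bounds count pairs (good subcube, vertex in it); a good subcube has 16 vertices. Upper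
bound: fix a vertex `v` and split the `n` directions by whether the neighbour of `v` lies on the
same side of `S` as `v`. Join directions from different parts when switching both returns to the
side of `v`. By `IsLocallyMatching`, each good subcube through `v` induces a two-edge matching in
this bipartite graph. A bipartite graph on `n` vertices has at most `n ^ 4 / 256` such matchings
(`card_induced_matchings_le`), so `goodCount` is at most `2 ^ n * n ^ 4 / 4096`. Lower bound: split
the coordinates into `d` nearly equal classes and let `S` be the vertices whose vector of class
parities lies in `H`. Every subcube whose free directions form a transversal is good
(`exists_iso_parityVector`). For `d = 4` both bounds, divided by the number of subcubes, tend to `24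
/ 256 = 3 / 32`. -/

/-! ### Isomorphisms onto subcubes, seen from one vertex. -/

/-- The vertex obtained from `v` by switching coordinate `i`. -/
def flipAt {n : ℕ} (v : CubeVertex n) (i : Fin n) : CubeVertex n := fun j => xor (v j) (decide (j = i))

/-- The subcube through `v` in which the coordinates in `J` vary. -/
def cubeThrough {n : ℕ} (v : CubeVertex n) (J : Finset (Fin n)) : Finset (CubeVertex n) :=
  Finset.univ.filter fun w => ∀ i, i ∉ J → w i = v i

theorem mem_cubeThrough {n : ℕ} {v w : CubeVertex n} {J : Finset (Fin n)} :
    w ∈ cubeThrough v J ↔ ∀ i, i ∉ J → w i = v i := by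
  simp [cubeThrough]

theorem self_mem_cubeThrough {n : ℕ} (v : CubeVertex n) (J : Finset (Fin n)) :
    v ∈ cubeThrough v J := by
  simp [cubeThrough]

theorem flipAt_mem_cubeThrough {n : ℕ} {v : CubeVertex n} {J : Finset (Fin n)} {i : Fin n} :
    flipAt v i ∈ cubeThrough v J ↔ i ∈ J := by
  rw [mem_cubeThrough]
  constructor
  · intro h
    by_contra hi
    simpa [flipAt] using h i hi
  · intro hi j hj
    have : j ≠ i := fun h => hj (h ▸ hi)
    simp [flipAt, this]

theorem flipAt_injective {n : ℕ} (v : CubeVertex n) : Function.Injective (flipAt v) := by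
  intro i j h
  by_contra hij
  have := congrFun h i
  simp [flipAt, hij] at this

theorem flipAt_comm {n : ℕ} (v : CubeVertex n) (i j : Fin n) :
    flipAt (flipAt v i) j = flipAt (flipAt v j) i := by
  funext k
  exact Bool.xor_right_comm _ _ _

theorem flipAt_flipAt_self {n : ℕ} (v : CubeVertex n) (i : Fin n) :
    flipAt (flipAt v i) i = v := by
  funext k
  simp [flipAt]

theorem cubeGraph_adj_iff {n : ℕ} {v w : CubeVertex n} :
    (cubeGraph n).Adj v w ↔ ∃ i, w = flipAt v i := by
  change hammingDist v w = 1 ↔ _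
  rw [hammingDist, Finset.card_eq_one]
  refine exists_congr fun i => ?_
  rw [Finset.ext_iff, funext_iff]
  refine forall_congr' fun j => ?_
  simp only [Finset.mem_filter_univ, Finset.mem_singleton, flipAt]
  cases v j <;> cases w j <;> by_cases h : j = i <;> simp [h]

/-- Two distinct neighbours of `v` have just one common neighbour other than `v`; this forces the
second direction. -/
theorem eq_of_flipAt_flipAt_eq {n : ℕ} {v : CubeVertex n} {i k p q : Fin n} (hik : i ≠ k)
    (h : flipAt (flipAt v i) p = flipAt (flipAt v k) q) (hv : flipAt (flipAt v i) p ≠ v) :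
    p = k := by
  by_contra hpk
  have hpi : p ≠ i := by
    rintro rfl
    exact hv (flipAt_flipAt_self _ _)
  by_cases hq : i = q
  · have h2 := congrFun h p
    simp [flipAt, hpi, hpk, ← hq] at h2
  · have h1 := congrFun h i
    simp [flipAt, hik, hpi.symm, hq] at h1

/-- An isomorphism from the `d`-cube to a subcube acts near each vertex as an injection of the set
of coordinates. -/
theorem exists_coordinate_map {d n : ℕ} {R : Finset (CubeVertex n)} (hR : IsSubcube d R)
    (φ : cubeGraph d ≃g (cubeGraph n).induce (R : Set (CubeVertex n))) (x : CubeVertex d) :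
    ∃ ρ : Fin d → Fin n, Function.Injective ρ ∧
      R = cubeThrough (φ x : CubeVertex n) (Finset.univ.image ρ) ∧
      (∀ i, (φ (flipAt x i) : CubeVertex n) = flipAt (φ x) (ρ i)) ∧
      ∀ i k, i ≠ k →
        (φ (flipAt (flipAt x i) k) : CubeVertex n) = flipAt (flipAt (φ x) (ρ i)) (ρ k) := by
  have key : ∀ (y : CubeVertex d) (i : Fin d), ∃ j,
      (φ (flipAt y i) : CubeVertex n) = flipAt (φ y) j := by
    intro y i
    have h : (cubeGraph d).Adj y (flipAt y i) := cubeGraph_adj_iff.2 ⟨i, rfl⟩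
    exact cubeGraph_adj_iff.1 (φ.map_rel_iff.2 h)
  choose ρ hρ using key
  have hinj : Function.Injective (ρ x) := by
    intro i k h
    have : φ (flipAt x i) = φ (flipAt x k) := Subtype.ext (by rw [hρ, hρ, h])
    exact flipAt_injective x (φ.injective this)
  refine ⟨ρ x, hinj, ?_, hρ x, ?_⟩
  · obtain ⟨J, a, hJ, hRJ⟩ := hR
    have hx := (hRJ _).1 (φ x).2
    have himg : Finset.univ.image (ρ x) = J := by
      refine Finset.eq_of_subset_of_card_le ?_ ?_
      · intro j hj
        obtain ⟨i, -, rfl⟩ := Finset.mem_image.1 hj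
        by_contra hi
        have h1 := (hRJ _).1 (φ (flipAt x i)).2 _ hi
        rw [hρ, ← hx _ hi] at h1
        simp [flipAt] at h1
      · rw [Finset.card_image_of_injective _ hinj, hJ, Finset.card_univ, Fintype.card_fin]
    rw [himg]
    ext w
    rw [hRJ, mem_cubeThrough]
    exact forall₂_congr fun i hi => by rw [hx i hi]
  · intro i k hik
    have h1 := hρ (flipAt x i) k
    have h2 := hρ (flipAt x k) i
    rw [hρ x] at h1 h2
    rw [flipAt_comm x k i] at h2
    have hp := eq_of_flipAt_flipAt_eq (fun h => hik (hinj h)) (h1.symm.trans h2) (by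
      rw [← h1]
      intro h
      have h3 : flipAt (flipAt x i) k = x := φ.injective (Subtype.ext h)
      have h4 := congrFun h3 i
      simp [flipAt, hik] at h4)
    rw [h1, hp]

theorem card_of_exactCopy {d n : ℕ} {H : Finset (CubeVertex d)} {S R : Finset (CubeVertex n)}
    (h : IsExactCopyOn H S R) : R.card = 2 ^ d := by
  obtain ⟨φ, -⟩ := h
  have := Fintype.card_congr φ.toEquiv
  simpa using this.symm

/-! ### Counting induced two-edge matchings. -/

open Finset in
/-- The number of induced matchings with two edges, both orders being counted, in a bipartite
graph. -/
theorem sum_mul_private_neighbors_le {α β : Type*} (A : Finset α) (B : Finset β)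
    (E : α → β → Prop) [∀ a b, Decidable (E a b)] :
    8 * ∑ a ∈ A, ∑ d ∈ A, #{b ∈ B | E a b ∧ ¬ E d b} * #{b ∈ B | E d b ∧ ¬ E a b} ≤
      #A ^ 2 * #B ^ 2 := by
  set x : α → α → ℕ := fun a d => #{b ∈ B | E a b ∧ ¬ E d b} with hx
  -- The two private neighbourhoods are disjoint in `B`, so `4xy ≤ (x + y)² ≤ #B (x + y)`.
  have h1 : ∀ a d, 4 * (x a d * x d a) ≤ #B * (x a d + x d a) := by
    intro a d
    have hle : x a d + x d a ≤ #B := by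
      rw [hx]
      classical
      dsimp only
      rw [← card_union_of_disjoint]
      · exact card_le_card (union_subset (filter_subset _ _) (filter_subset _ _))
      · rw [disjoint_filter]
        tauto
    nlinarith [Nat.mul_le_mul_right (x a d + x d a) hle, four_mul_le_sq_add (x a d) (x d a)]
  have h2 : 4 * ∑ a ∈ A, ∑ d ∈ A, x a d ≤ #B * #A ^ 2 := by
    -- Count by `b` instead: its neighbours times its non-neighbours, at most `#A ^ 2 / 4`.
    have hs : ∑ a ∈ A, ∑ d ∈ A, x a d =
        ∑ b ∈ B, #{a ∈ A | E a b} * #{a ∈ A | ¬ E a b} := by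
      simp only [hx, card_filter, sum_mul_sum]
      rw [sum_congr rfl fun a _ => sum_comm, sum_comm]
      refine sum_congr rfl fun b _ => sum_congr rfl fun a _ => sum_congr rfl fun d _ => ?_
      by_cases ha : E a b <;> by_cases hd : E d b <;> simp [ha, hd]
    rw [hs, mul_sum, ← smul_eq_mul #B, ← sum_const]
    refine sum_le_sum fun b _ => ?_
    rw [← card_filter_add_card_filter_not (s := A) (fun a => E a b), ← mul_assoc]
    exact four_mul_le_sq_add _ _
  have h3 : ∑ a ∈ A, ∑ d ∈ A, (x a d + x d a) = 2 * ∑ a ∈ A, ∑ d ∈ A, x a d := by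
    simp only [sum_add_distrib]
    rw [sum_comm (f := fun a d => x d a), two_mul]
  have h4 : 4 * ∑ a ∈ A, ∑ d ∈ A, x a d * x d a ≤
      #B * ∑ a ∈ A, ∑ d ∈ A, (x a d + x d a) := by
    simp only [mul_sum]
    exact sum_le_sum fun a _ => sum_le_sum fun d _ => by
      simpa only [mul_assoc] using h1 a d
  rw [h3] at h4
  nlinarith [Nat.mul_le_mul_left #B h2]

-- The parts have product at most `n ^ 2 / 4`, whence `128 = 8 * 16`. The tuples are ordered, so
-- each matching appears twice.
open Finset in
theorem card_induced_matchings_le {α : Type*} [Fintype α] (p : α → Prop) (E : α → α → Prop)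
    [DecidablePred p] [∀ a b, Decidable (E a b)] :
    128 * #{t : (α × α) × α × α | (p t.1.1 ∧ p t.1.2) ∧ (¬ p t.2.1 ∧ ¬ p t.2.2) ∧
      (E t.1.1 t.2.1 ∧ ¬ E t.1.2 t.2.1) ∧ (E t.1.2 t.2.2 ∧ ¬ E t.1.1 t.2.2)} ≤
      Fintype.card α ^ 4 := by
  have h := sum_mul_private_neighbors_le (univ.filter p) (univ.filter fun a => ¬ p a) E
  have hn := card_filter_add_card_filter_not (s := (univ : Finset α)) p
  rw [card_univ] at hn
  have hcard : #{t : (α × α) × α × α | (p t.1.1 ∧ p t.1.2) ∧ (¬ p t.2.1 ∧ ¬ p t.2.2) ∧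
      (E t.1.1 t.2.1 ∧ ¬ E t.1.2 t.2.1) ∧ (E t.1.2 t.2.2 ∧ ¬ E t.1.1 t.2.2)} =
      ∑ a with p a, ∑ d with p d, #{b ∈ univ.filter fun a => ¬ p a | E a b ∧ ¬ E d b} *
        #{b ∈ univ.filter fun a => ¬ p a | E d b ∧ ¬ E a b} := by
    simp only [card_filter, sum_mul_sum, sum_filter, Fintype.sum_prod_type]
    refine sum_congr rfl fun a _ => ?_
    by_cases ha : p a
    · simp only [ha, true_and, if_true]
      refine sum_congr rfl fun d _ => ?_
      by_cases hd : p d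
      · simp only [hd, true_and, if_true]
        refine sum_congr rfl fun b _ => ?_
        by_cases hb : p b
        · simp [hb]
        · simp only [hb, not_false_eq_true, true_and, if_true]
          refine sum_congr rfl fun c _ => ?_
          by_cases hc : p c
          · simp [hc]
          · by_cases h1 : E a b ∧ ¬ E d b <;> simp [hc, h1]
      · simp [hd]
    · simp [ha]
  rw [hcard]
  set q := #(univ.filter p)
  set r := #(univ.filter fun a => ¬ p a)
  have h5 : 4 * q * r ≤ (q + r) ^ 2 := four_mul_le_sq_add q r
  have h6 := Nat.pow_le_pow_left h5 2
  rw [hn] at h6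
  nlinarith

/-! ### Perfect 8-cycles and their local structure. -/

/-- At every vertex `x` of the `4`-cube the coordinates can be named `a`, `b`, `c`, `d` so that the
neighbours of `x` in directions `a`, `d` lie on the same side of `C` as `x`, those in directions
`b`, `c` do not, and among the four vertices at distance two obtained by switching one coordinate
of each kind exactly those for `ab` and `dc` lie on the same side of `C` as `x`. -/
def IsLocallyMatching (C : Finset (CubeVertex 4)) : Prop :=
  ∀ x, ∃ a b c d : Fin 4, a ≠ b ∧ a ≠ c ∧ a ≠ d ∧ b ≠ d ∧ c ≠ d ∧
    (∀ k, k = a ∨ k = b ∨ k = c ∨ k = d) ∧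
    (flipAt x a ∈ C ↔ x ∈ C) ∧ (flipAt x d ∈ C ↔ x ∈ C) ∧
    ¬ (flipAt x b ∈ C ↔ x ∈ C) ∧ ¬ (flipAt x c ∈ C ↔ x ∈ C) ∧
    (flipAt (flipAt x a) b ∈ C ↔ x ∈ C) ∧ ¬ (flipAt (flipAt x d) b ∈ C ↔ x ∈ C) ∧
    (flipAt (flipAt x d) c ∈ C ↔ x ∈ C) ∧ ¬ (flipAt (flipAt x a) c ∈ C ↔ x ∈ C)

/-- The perfect `8`-cycle that starts at the origin and switches the coordinates in their natural
cyclic order. -/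
def standardCycle (t : ZMod (2 * 4)) : CubeVertex 4 :=
  fun k => decide (k.val < t.val ∧ t.val ≤ k.val + 4)

theorem isPerfectCycle_image_standardCycle :
    IsPerfectCycle 4 (Finset.univ.image standardCycle) := by
  refine ⟨by norm_num, standardCycle, ?_, ?_, ?_, fun v => by simp⟩
  · change ∀ i j, _ → _
    decide +kernel
  · intro i
    change hammingDist _ _ = 1
    revert i
    decide +kernel
  · decide +kernel

set_option synthInstance.maxHeartbeats 400000 in
set_option synthInstance.maxSize 1000 in
theorem isLocallyMatching_image_standardCycle :
    IsLocallyMatching (Finset.univ.image standardCycle) := by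
  unfold IsLocallyMatching
  decide +kernel

theorem standardCycle_succ (t : ℕ) :
    standardCycle ((t : ZMod (2 * 4)) + 1) =
      flipAt (standardCycle t) ⟨t % 4, Nat.mod_lt _ (by norm_num)⟩ := by
  have h : ∀ t : ZMod (2 * 4), standardCycle (t + 1) =
      flipAt (standardCycle t) ⟨t.val % 4, Nat.mod_lt _ (by norm_num)⟩ := by
    decide +kernel
  rw [h t]
  congr 2
  rw [ZMod.val_natCast]
  omega

/-- The automorphism of the `n`-cube that permutes the coordinates and then translates. -/
def cubeMotion {n : ℕ} (v : CubeVertex n) (σ : Equiv.Perm (Fin n)) (x : CubeVertex n) :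
    CubeVertex n :=
  fun j => xor (v j) (x (σ.symm j))

theorem cubeMotion_injective {n : ℕ} (v : CubeVertex n) (σ : Equiv.Perm (Fin n)) :
    Function.Injective (cubeMotion v σ) := by
  intro x y h
  funext k
  have := congrFun h (σ k)
  simpa [cubeMotion] using this

theorem cubeMotion_flipAt {n : ℕ} (v : CubeVertex n) (σ : Equiv.Perm (Fin n)) (x : CubeVertex n)
    (k : Fin n) : cubeMotion v σ (flipAt x k) = flipAt (cubeMotion v σ x) (σ k) := by
  funext j
  simp only [cubeMotion, flipAt, Bool.xor_assoc, Equiv.symm_apply_eq]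

theorem IsLocallyMatching.image_cubeMotion {C : Finset (CubeVertex 4)} (hC : IsLocallyMatching C)
    (v : CubeVertex 4) (σ : Equiv.Perm (Fin 4)) :
    IsLocallyMatching (C.image (cubeMotion v σ)) := by
  intro x
  obtain ⟨y, rfl⟩ := Finite.surjective_of_injective (cubeMotion_injective v σ) x
  obtain ⟨a, b, c, d, h1, h2, h3, h4, h5, h6, h7⟩ := hC y
  refine ⟨σ a, σ b, σ c, σ d, σ.injective.ne h1, σ.injective.ne h2, σ.injective.ne h3,
    σ.injective.ne h4, σ.injective.ne h5, fun k => ?_, ?_⟩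
  · simpa only [Equiv.symm_apply_eq] using h6 (σ.symm k)
  · simpa only [← cubeMotion_flipAt, (cubeMotion_injective v σ).mem_finset_image] using h7

/-- Every perfect `8`-cycle is the image of the standard one under an automorphism. -/
theorem IsPerfectCycle.exists_eq_image {C : Finset (CubeVertex 4)} (hC : IsPerfectCycle 4 C) :
    ∃ v σ, C = (Finset.univ.image standardCycle).image (cubeMotion v σ) := by
  obtain ⟨-, c, -, hadj, hopp, hmem⟩ := hC
  choose s hs using fun i => cubeGraph_adj_iff.1 (hadj i)
  have h4 : ∀ i, c (i + 4) =
      flipAt (flipAt (flipAt (flipAt (c i) (s i)) (s (i + 1))) (s (i + 2))) (s (i + 3)) := by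
    intro i
    rw [← hs i, ← hs (i + 1), show i + 1 + 1 = i + 2 by ring, ← hs (i + 2),
      show i + 2 + 1 = i + 3 by ring, ← hs (i + 3), show i + 3 + 1 = i + 4 by ring]
  -- A coordinate missed by four consecutive steps would agree at opposite vertices, which differ
  -- everywhere.
  have hcover : ∀ i j, j = s i ∨ j = s (i + 1) ∨ j = s (i + 2) ∨ j = s (i + 3) := by
    intro i j
    have h := hopp i
    have hj : c i j ≠ c (i + 4) j := by
      have h' : (Finset.univ.filter fun j => c i j ≠ c (i + ((4 : ℕ) : ZMod (2 * 4))) j) =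
          Finset.univ := by
        rw [← Finset.card_eq_iff_eq_univ]
        exact h
      have hm := Finset.mem_univ j
      rw [← h', Finset.mem_filter] at hm
      exact hm.2
    by_contra hne
    push Not at hne
    rw [h4] at hj
    simp [flipAt, hne] at hj
  have hbij : ∀ i, Function.Bijective fun k : Fin 4 => s (i + (k.val : ℕ)) := by
    intro i
    refine Finite.injective_iff_bijective.1 (Finite.injective_iff_surjective.2 fun j => ?_)
    rcases hcover i j with h | h | h | h
    · exact ⟨0, by simp [h]⟩
    · exact ⟨1, by simp [h]⟩
    · exact ⟨2, by simp [h]⟩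
    · exact ⟨3, by simp [h]⟩
  -- Steps `i + 1, …, i + 4` use distinct directions, so the last one can only repeat that of step
  -- `i`.
  have hper : ∀ i, s (i + 4) = s i := by
    intro i
    have hne : ∀ k : Fin 4, k ≠ 3 → s (i + 1 + (k.val : ℕ)) ≠ s (i + 1 + 3) := fun k hk h =>
      hk ((hbij (i + 1)).1 (by simpa using h))
    have h0 := hne 0 (by decide)
    have h1 := hne 1 (by decide)
    have h2 := hne 2 (by decide)
    have e : i + 1 + 3 = i + 4 := by ring
    have e1 : i + 1 + 1 = i + 2 := by ring
    have e2 : i + 1 + 2 = i + 3 := by ring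
    simp [e, e1, e2] at h0 h1 h2
    rcases hcover i (s (i + 4)) with h | h | h | h
    · exact h
    · exact absurd h.symm h0
    · exact absurd h.symm h1
    · exact absurd h.symm h2
  have hmod : ∀ t : ℕ, s t = s ((t % 4 : ℕ) : ZMod (2 * 4)) := by
    intro t
    induction t using Nat.strong_induction_on with
    | _ t ih =>
      rcases Nat.lt_or_ge t 4 with h | h
      · rw [Nat.mod_eq_of_lt h]
      · have h5 := hper ((t - 4 : ℕ) : ZMod (2 * 4))
        have h6 : ((t - 4 : ℕ) : ZMod (2 * 4)) + 4 = t := by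
          rw [Nat.cast_sub h]
          push_cast
          ring
        rw [h6, ih (t - 4) (by omega)] at h5
        rw [h5]
        congr 2
        omega
  set σ : Equiv.Perm (Fin 4) := Equiv.ofBijective _ (hbij 0) with hσ
  have hc : ∀ t : ℕ, c t = cubeMotion (c 0) σ (standardCycle t) := by
    intro t
    induction t with
    | zero =>
      funext j
      simp [cubeMotion, standardCycle]
    | succ t ih =>
      rw [Nat.cast_succ, standardCycle_succ, cubeMotion_flipAt, ← ih, hs t, hmod t]
      simp [hσ]
  refine ⟨c 0, σ, ?_⟩
  ext v
  rw [hmem, Finset.image_image]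
  simp only [Finset.mem_image, Finset.mem_univ, true_and, Function.comp_apply]
  refine exists_congr fun i => ?_
  rw [← ZMod.natCast_zmod_val i, hc]

theorem IsPerfectCycle.isLocallyMatching {C : Finset (CubeVertex 4)} (hC : IsPerfectCycle 4 C) :
    IsLocallyMatching C := by
  obtain ⟨v, σ, rfl⟩ := hC.exists_eq_image
  exact isLocallyMatching_image_standardCycle.image_cubeMotion v σ

/-! ### The upper bound. -/

open Finset in
open scoped Classical in
theorem card_exactCopies_through_le {C : Finset (CubeVertex 4)} (hC : IsLocallyMatching C) {n : ℕ}
    (S : Finset (CubeVertex n)) (v : CubeVertex n) :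
    256 * #{R : Finset (CubeVertex n) | (IsSubcube 4 R ∧ IsExactCopyOn C S R) ∧ v ∈ R} ≤ n ^ 4 := by
  have hT := card_induced_matchings_le (fun i => flipAt v i ∈ S ↔ v ∈ S)
    (fun i j => flipAt (flipAt v i) j ∈ S ↔ v ∈ S)
  rw [Fintype.card_fin] at hT
  refine le_trans ?_ hT
  -- The factor 2: each copy yields its matching in both orders, and a tuple determines the copy.
  rw [show 256 = 128 * 2 from rfl, mul_assoc]
  refine Nat.mul_le_mul_left _ ?_
  rw [mul_comm, ← mul_one (card (filter _ (univ : Finset ((Fin n × Fin n) × Fin n × Fin n))))]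
  refine card_mul_le_card_mul
    (fun R t => R = cubeThrough v {t.1.1, t.1.2, t.2.1, t.2.2}) ?_ ?_
  · intro R hR
    obtain ⟨⟨hR, φ, hφ⟩, hv⟩ := (mem_filter.1 hR).2
    obtain ⟨x, hx⟩ := φ.surjective ⟨v, hv⟩
    obtain ⟨ρ, hρ, hRρ, h1, h2⟩ := exists_coordinate_map hR φ x
    rw [hx] at hRρ h1 h2
    dsimp only at hRρ h1 h2
    obtain ⟨a, b, c, d, hab, hac, had, hbd, hcd, hall, m⟩ := hC x
    simp only [hφ, h1, h2 _ _ hab, h2 _ _ hac, h2 _ _ hbd.symm, h2 _ _ hcd.symm, hx] at m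
    obtain ⟨ma, md, mb, mc, mab, mdb, mdc, mac⟩ := m
    have himg : univ.image ρ = {ρ a, ρ d, ρ b, ρ c} := by
      ext j
      simp only [mem_image, mem_univ, true_and, mem_insert, mem_singleton]
      constructor
      · rintro ⟨k, rfl⟩
        rcases hall k with rfl | rfl | rfl | rfl <;> simp
      · rintro (rfl | rfl | rfl | rfl) <;> exact ⟨_, rfl⟩
    have himg' : univ.image ρ = {ρ d, ρ a, ρ c, ρ b} := by
      rw [himg, insert_comm (ρ a), pair_comm (ρ b)]
    have hne : ((ρ a, ρ d), ρ b, ρ c) ≠ ((ρ d, ρ a), ρ c, ρ b) := fun h =>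
      had (hρ (Prod.mk.inj (Prod.mk.inj h).1).1)
    rw [← card_pair hne]
    refine card_le_card ?_
    intro t ht
    rw [mem_bipartiteAbove, mem_filter]
    rcases mem_insert.1 ht with rfl | ht
    · exact ⟨⟨mem_univ _, ⟨ma, md⟩, ⟨mb, mc⟩, ⟨mab, mdb⟩, mdc, mac⟩, hRρ.trans (by rw [himg])⟩
    · rw [mem_singleton.1 ht]
      exact ⟨⟨mem_univ _, ⟨md, ma⟩, ⟨mc, mb⟩, ⟨mdc, mac⟩, mab, mdb⟩, hRρ.trans (by rw [himg'])⟩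
  · intro t _
    refine card_le_one.2 fun R hR R' hR' => ?_
    rw [mem_bipartiteBelow] at hR hR'
    exact hR.2.trans hR'.2.symm

open Finset in
theorem goodCount_le {C : Finset (CubeVertex 4)} (hC : IsLocallyMatching C) {n : ℕ}
    (S : Finset (CubeVertex n)) : 4096 * goodCount C S ≤ 2 ^ n * n ^ 4 := by
  classical
  have h : goodCount C S * 16 ≤ #(univ : Finset (CubeVertex n)) * (n ^ 4 / 256) := by
    refine card_mul_le_card_mul (fun R v => v ∈ R) ?_ ?_
    · intro R hR
      have := card_of_exactCopy (mem_filter.1 hR).2.2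
      rw [bipartiteAbove, filter_univ_mem, this]
      norm_num
    · intro v _
      rw [Nat.le_div_iff_mul_le (by norm_num), mul_comm]
      refine le_trans (le_of_eq ?_) (card_exactCopies_through_le hC S v)
      rw [bipartiteBelow, filter_filter]
  have h' : #(univ : Finset (CubeVertex n)) = 2 ^ n := by simp
  rw [h'] at h
  calc 4096 * goodCount C S = 256 * (goodCount C S * 16) := by ring
    _ ≤ 256 * (2 ^ n * (n ^ 4 / 256)) := Nat.mul_le_mul_left _ h
    _ = 2 ^ n * (n ^ 4 / 256 * 256) := by ring
    _ ≤ 2 ^ n * n ^ 4 := Nat.mul_le_mul_left _ (Nat.div_mul_le_self _ _)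

theorem goodMax_le {C : Finset (CubeVertex 4)} (hC : IsLocallyMatching C) (n : ℕ) :
    4096 * goodMax C n ≤ 2 ^ n * n ^ 4 := by
  obtain ⟨S, -, hS⟩ := Finset.exists_mem_eq_sup (Finset.univ : Finset (Finset (CubeVertex n)))
    Finset.univ_nonempty (fun S => goodCount C S)
  rw [goodMax, hS]
  exact goodCount_le hC S

/-! ### The lower bound: the parity construction. -/

/-- The parities of the number of ones of `v` in the classes of coordinates given by `cls`. -/
def parityVector {d n : ℕ} (cls : Fin n → Fin d) (v : CubeVertex n) : CubeVertex d :=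
  fun k => Nat.bodd (∑ j with cls j = k, (v j).toNat)

/-- Both sides are the parity of the class without `i`. -/
theorem parityVector_xor_eq {d n : ℕ} {cls : Fin n → Fin d} {v w : CubeVertex n} {k : Fin d}
    {i : Fin n} (hi : cls i = k) (h : ∀ j, cls j = k → j ≠ i → v j = w j) :
    xor (parityVector cls v k) (v i) = xor (parityVector cls w k) (w i) := by
  have hb : ∀ b : Bool, Nat.bodd b.toNat = b := by decide
  have hm : i ∈ Finset.univ.filter fun j => cls j = k := by simp [hi]
  have hs : ∑ j ∈ (Finset.univ.filter fun j => cls j = k).erase i, (v j).toNat =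
      ∑ j ∈ (Finset.univ.filter fun j => cls j = k).erase i, (w j).toNat :=
    Finset.sum_congr rfl fun j hj => by
      rw [Finset.mem_erase, Finset.mem_filter] at hj
      rw [h j hj.2.2 hj.1]
  simp only [parityVector]
  rw [← Finset.add_sum_erase _ _ hm, ← Finset.add_sum_erase _ (fun j => (w j).toNat) hm, hs,
    Nat.bodd_add, Nat.bodd_add, hb, hb]
  rw [Bool.xor_right_comm, Bool.xor_self, Bool.xor_right_comm, Bool.xor_self]

/-- On a subcube whose free coordinates form a transversal of the classes, the parity vector is an
isomorphism onto the `d`-cube. -/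
theorem exists_iso_parityVector {d n : ℕ} {cls : Fin n → Fin d} {i : Fin d → Fin n}
    (hi : ∀ k, cls (i k) = k) (v : CubeVertex n) :
    ∃ φ : cubeGraph d ≃g
      (cubeGraph n).induce (cubeThrough v (Finset.univ.image i) : Set (CubeVertex n)),
      ∀ x, parityVector cls (φ x : CubeVertex n) = x := by
  -- The only free coordinate of each class is switched exactly when the parity of that class must
  -- change.
  set lift : CubeVertex d → CubeVertex n := fun x j =>
    if j = i (cls j) then xor (v j) (xor (x (cls j)) (parityVector cls v (cls j))) else v j
    with hlift
  have hinj : Function.Injective i := fun k l h => by rw [← hi k, h, hi]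
  have hJ : ∀ j, j ∈ Finset.univ.image i ↔ j = i (cls j) := by
    intro j
    simp only [Finset.mem_image, Finset.mem_univ, true_and]
    constructor
    · rintro ⟨k, rfl⟩
      rw [hi]
    · intro h
      exact ⟨_, h.symm⟩
  have hmem : ∀ x, lift x ∈ cubeThrough v (Finset.univ.image i) := by
    intro x
    rw [mem_cubeThrough]
    intro j hj
    rw [hJ] at hj
    simp [hlift, hj]
  have hleft : ∀ x, parityVector cls (lift x) = x := by
    intro x
    funext k
    have h := parityVector_xor_eq (v := lift x) (w := v) (hi k) (by
      intro j hj hne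
      rw [← hj] at hne
      simp [hlift, hne])
    simp only [hlift, hi, if_true] at h ⊢
    revert h
    generalize parityVector cls _ k = p
    generalize parityVector cls v k = q
    cases p <;> cases q <;> cases x k <;> cases v (i k) <;> decide
  have hright : ∀ w ∈ cubeThrough v (Finset.univ.image i), lift (parityVector cls w) = w := by
    intro w hw
    rw [mem_cubeThrough] at hw
    funext j
    by_cases hj : j = i (cls j)
    · have h := parityVector_xor_eq (v := w) (w := v) (i := j) (k := cls j) rfl (by
        intro l hl hne
        refine hw l fun hl' => ?_
        rw [hJ, hl, ← hj] at hl'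
        exact hne hl')
      simp only [hlift, ← hj, if_true]
      revert h
      generalize parityVector cls w _ = p
      generalize parityVector cls v _ = q
      cases p <;> cases q <;> cases w j <;> cases v j <;> decide
    · simp only [hlift, hj, if_false]
      exact (hw j (by rwa [hJ])).symm
  refine ⟨⟨⟨fun x => ⟨lift x, hmem x⟩, fun w => parityVector cls w.1, hleft,
    fun w => Subtype.ext (hright w.1 w.2)⟩, ?_⟩, hleft⟩
  intro x y
  change hammingDist (lift x) (lift y) = 1 ↔ hammingDist x y = 1
  have h : (Finset.univ.filter fun j => lift x j ≠ lift y j) =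
      (Finset.univ.filter fun k => x k ≠ y k).image i := by
    ext j
    simp only [Finset.mem_filter_univ, Finset.mem_image]
    constructor
    · intro h
      by_cases hj : j = i (cls j)
      · refine ⟨cls j, fun he => h ?_, hj.symm⟩
        simp only [hlift, he]
      · simp [hlift, hj] at h
    · rintro ⟨k, hk, rfl⟩ he
      simp only [hlift, hi, if_true, Bool.xor_right_inj, Bool.xor_left_inj] at he
      exact hk he
  rw [hammingDist, h, Finset.card_image_of_injective _ hinj, hammingDist]

open Finset in
theorem le_goodMax {d : ℕ} (H : Finset (CubeVertex d)) (hd : 0 < d) {m n : ℕ}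
    (hmn : d * m ≤ n) :
    2 ^ n * m ^ d ≤ goodMax H n * 2 ^ d := by
  classical
  set cls : Fin n → Fin d := fun j => ⟨j.val % d, Nat.mod_lt _ hd⟩ with hcls
  set S : Finset (CubeVertex n) := univ.filter fun v => parityVector cls v ∈ H with hS
  have h1 : goodCount H S ≤ goodMax H n := le_sup (f := fun S => goodCount H S) (mem_univ S)
  refine le_trans ?_ (Nat.mul_le_mul_right _ h1)
  have h2 : #(univ : Finset (CubeVertex n)) = 2 ^ n := by simp
  rw [← h2]
  refine card_mul_le_card_mul (fun v R => v ∈ R) ?_ ?_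
  · intro v _
    -- Each `f` picks a transversal: the element numbered `f k` of the residue class `k` modulo `d`.
    set idx : (Fin d → Fin m) → Fin d → Fin n := fun f k => ⟨d * (f k).val + k.val, by
      calc d * (f k).val + k.val < d * (f k).val + d := by omega
        _ = d * ((f k).val + 1) := by ring
        _ ≤ d * m := Nat.mul_le_mul_left _ (f k).2
        _ ≤ n := hmn⟩ with hidx
    have hclsidx : ∀ f k, cls (idx f k) = k := by
      intro f k
      ext
      simp [hcls, hidx, Nat.mod_eq_of_lt k.2]
    have hidxinj : ∀ f, Function.Injective (idx f) := fun f k l h => by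
      rw [← hclsidx f k, h, hclsidx]
    have h3 : #(univ : Finset (Fin d → Fin m)) = m ^ d := by simp
    rw [← h3]
    refine card_le_card_of_injOn (fun f => cubeThrough v (univ.image (idx f))) ?_ ?_
    · intro f _
      rw [mem_coe, mem_bipartiteAbove, mem_filter]
      refine ⟨⟨mem_univ _, ⟨univ.image (idx f), v, ?_, fun w => mem_cubeThrough⟩, ?_⟩,
        self_mem_cubeThrough _ _⟩
      · rw [card_image_of_injective _ (hidxinj f), card_univ, Fintype.card_fin]
      · obtain ⟨φ, hφ⟩ := exists_iso_parityVector (hclsidx f) v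
        refine ⟨φ, fun x => ?_⟩
        rw [hS, mem_filter_univ, hφ]
    · intro f _ g _ hfg
      dsimp only at hfg
      funext k
      have h4 : idx f k ∈ univ.image (idx g) := by
        rw [← flipAt_mem_cubeThrough (v := v), ← hfg, flipAt_mem_cubeThrough]
        exact mem_image_of_mem _ (mem_univ _)
      obtain ⟨l, -, hl⟩ := mem_image.1 h4
      have hlk : l = k := by rw [← hclsidx g l, hl, hclsidx]
      subst hlk
      have h5 := congrArg Fin.val hl
      simp only [hidx, Nat.add_right_cancel_iff] at h5
      exact Fin.ext (Nat.eq_of_mul_eq_mul_left hd h5).symm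
  · intro R hR
    have h6 := card_of_exactCopy (mem_filter.1 hR).2.2
    rw [bipartiteBelow, filter_univ_mem, h6]

/-! ### Passage to the limit. -/

theorem tendsto_pow_div_choose (d : ℕ) :
    Tendsto (fun n : ℕ => (n : ℝ) ^ d / (n.choose d : ℝ)) atTop (𝓝 d.factorial) := by
  have h := (isEquivalent_choose d).symm
  have h0 : ∀ᶠ n : ℕ in atTop, (n.choose d : ℝ) ≠ 0 := by
    filter_upwards [eventually_ge_atTop d] with n hn
    exact_mod_cast (Nat.choose_pos hn).ne'
  have h1 := ((Asymptotics.isEquivalent_iff_tendsto_one h0).1 h).const_mul (d.factorial : ℝ)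
  rw [mul_one] at h1
  refine h1.congr fun n => ?_
  have := Nat.factorial_ne_zero d
  simp only [Pi.div_apply]
  field_simp

theorem IsLocallyMatching.hasCubeDensity {C : Finset (CubeVertex 4)} (hC : IsLocallyMatching C) :
    HasCubeDensity C (3 / 32) := by
  have hupper : Tendsto (fun n : ℕ => 1 / 256 * ((n : ℝ) ^ 4 / (n.choose 4 : ℝ))) atTop
      (𝓝 (3 / 32)) := by
    have := (tendsto_pow_div_choose 4).const_mul (1 / 256 : ℝ)
    norm_num [Nat.factorial] at this ⊢
    exact this
  have hfloor : Tendsto (fun n : ℕ => ((n / 4 : ℕ) : ℝ) / (n : ℝ)) atTop (𝓝 (1 / 4)) := by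
    have := (tendsto_nat_floor_mul_div_atTop (R := ℝ) (a := 1 / 4) (by norm_num)).comp
      tendsto_natCast_atTop_atTop
    refine this.congr fun n => ?_
    have h : ⌊(1 / 4 : ℝ) * n⌋₊ = n / 4 := by
      rw [one_div_mul_eq_div]
      exact_mod_cast Nat.floor_div_eq_div (K := ℝ) n 4
    simp only [Function.comp_apply, h]
  have hlower : Tendsto (fun n : ℕ => ((n / 4 : ℕ) : ℝ) ^ 4 / (n.choose 4 : ℝ)) atTop
      (𝓝 (3 / 32)) := by
    have := (hfloor.pow 4).mul (tendsto_pow_div_choose 4)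
    rw [show (1 / 4 : ℝ) ^ 4 * ((4 : ℕ).factorial : ℝ) = 3 / 32 by norm_num [Nat.factorial]] at this
    refine this.congr' ?_
    filter_upwards [eventually_gt_atTop 0] with n hn
    have : (n : ℝ) ≠ 0 := by positivity
    field_simp
  refine tendsto_of_tendsto_of_tendsto_of_le_of_le' hlower hupper ?_ ?_
  · filter_upwards [eventually_ge_atTop 4] with n hn
    have h := le_goodMax C (by norm_num) (m := n / 4) (n := n) (by omega)
    have hc : (0 : ℝ) < n.choose 4 := by exact_mod_cast Nat.choose_pos hn
    have hp : (2 : ℝ) ^ n = 2 ^ (n - 4) * 2 ^ 4 := by rw [← pow_add, Nat.sub_add_cancel hn]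
    have h' : (2 : ℝ) ^ n * ((n / 4 : ℕ) : ℝ) ^ 4 ≤ goodMax C n * 2 ^ 4 := by exact_mod_cast h
    rw [maxFraction, div_le_div_iff₀ hc (by positivity)]
    rw [hp] at h'
    nlinarith
  · filter_upwards [eventually_ge_atTop 4] with n hn
    have h := goodMax_le hC n
    have hc : (0 : ℝ) < n.choose 4 := by exact_mod_cast Nat.choose_pos hn
    have hp : (2 : ℝ) ^ n = 2 ^ (n - 4) * 2 ^ 4 := by rw [← pow_add, Nat.sub_add_cancel hn]
    have h' : 4096 * (goodMax C n : ℝ) ≤ 2 ^ n * (n : ℝ) ^ 4 := by exact_mod_cast h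
    rw [hp] at h'
    rw [maxFraction, one_div_mul_eq_div, div_div, div_le_div_iff₀ (by positivity) (by positivity)]
    nlinarith

theorem theorem1 :
    (∃ C : Finset (CubeVertex 4), IsPerfectCycle 4 C) ∧
      ∀ C : Finset (CubeVertex 4), IsPerfectCycle 4 C → HasCubeDensity C (3 / 32) :=
  ⟨⟨_, isPerfectCycle_image_standardCycle⟩, fun _ hC => hC.isLocallyMatching.hasCubeDensity⟩
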